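/- Let $\mathbb C^{m}\otimes\mathbb C^{k}$ be a finite-dimensional bipartite quantum system in which at least one subsystem is a qubit, i.e. $m=2$ or $k=2$. A state is a positive semidefinite matrix of unit trace, $A\mapsto A^\Gamma$ is partial transposition with respect to one fixed subsystem, a state $\sigma$ is PPT if $\sigma^\Gamma\ge 0$, and $|A|=\sqrt{A^\dagger A}$. For states $\rho,\sigma$ let $S(\rho\|\sigma)=\operatorname{Tr}[\rho\log\rho]-\operatorname{Tr}[\rho\log\sigma]$ (natural logarithm, with the convention $0\log 0=0$) if the support of $\rho$ is contained in the support of $\sigma$, and $S(\rho\|\sigma)=+\infty$ otherwise. Define the Rains bound and the PPT relative entropy of entanglement of a state $\rho$ by $$R(\rho)=\min_{\sigma\ \text{a state}}\bigl(S(\rho\|\sigma)+\log\operatorname{Tr}|\sigma^\Gamma|\bigr),\qquad E_{\mathcal P}(\rho)=\min_{\sigma\ \text{a PPT state}}S(\rho\|\sigma).$$ Theorem. For every state $\rho$ of such a system, both minima are attained, and $R(\rho)=E_{\mathcal P}(\rho)$. -/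

import Mathlib

open scoped Matrix ComplexOrder

noncomputable section

namespace RainsPPT

variable {m k n : Type*} [Fintype m] [DecidableEq m] [Fintype k] [DecidableEq k]
  [Fintype n] [DecidableEq n]

/-- Density matrices (quantum states): positive semidefinite matrices of unit trace. -/
def states (n : Type*) [Fintype n] : Set (Matrix n n ℂ) :=
  {ρ | ρ.PosSemidef ∧ ρ.trace = 1}

/-- Partial transposition `A ↦ A^Γ` of a matrix of a bipartite system, on the second factor. -/
def partialTranspose (A : Matrix (m × k) (m × k) ℂ) : Matrix (m × k) (m × k) ℂ :=
  Matrix.of fun x y => A (x.1, y.2) (y.1, x.2)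

/-- The trace norm `Tr |A|`, where `|A| = √(A† A)`. -/
def traceNorm (A : Matrix n n ℂ) : ℝ :=
  (cfc Real.sqrt (Aᴴ * A)).trace.re

open Classical in
/-- The relative entropy `S(ρ‖σ) = Tr[ρ log ρ] - Tr[ρ log σ]` of positive semidefinite matrices
with values in the extended reals; it is `+∞` if the support of `ρ` is not contained in the
support of `σ`. The functional calculus uses `Real.log 0 = 0`, that is, `log` is taken on the
support, which is the usual convention `0 log 0 = 0`. -/
def relEntropy (ρ σ : Matrix n n ℂ) : EReal :=
  if ∀ v : n → ℂ, σ *ᵥ v = 0 → ρ *ᵥ v = 0 then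
    (((ρ * cfc Real.log ρ).trace.re - (ρ * cfc Real.log σ).trace.re : ℝ) : EReal)
  else ⊤

/-- The logarithmic negativity `log Tr |σ^Γ|`. -/
def logNegativity (σ : Matrix (m × k) (m × k) ℂ) : ℝ :=
  Real.log (traceNorm (partialTranspose σ))

/-- The states with positive partial transpose (PPT states). -/
def pptStates (m k : Type*) [Fintype m] [Fintype k] : Set (Matrix (m × k) (m × k) ℂ) :=
  {σ | σ ∈ states (m × k) ∧ (partialTranspose σ).PosSemidef}

/-- The PPT relative entropy of entanglement `E_P(ρ)`. -/
def pptRelEntropyEntanglement (ρ : Matrix (m × k) (m × k) ℂ) : EReal :=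
  ⨅ σ ∈ pptStates m k, relEntropy ρ σ

/-- The Rains bound `R(ρ)`: the infimum, over all states `σ`, of
`S(ρ‖σ) + log Tr |σ^Γ|`. -/
def rainsBound (ρ : Matrix (m × k) (m × k) ℂ) : EReal :=
  ⨅ σ ∈ states (m × k), relEntropy ρ σ + (logNegativity σ : EReal)

end RainsPPT

end

/-! PPT states have zero logarithmic negativity, so R ≤ E_P. For the converse, every state σ
satisfies σ ≤ cτ with c = Tr|σ^Γ| and τ a PPT state (`exists_pptState_dominating`); operator
monotonicity of log then gives S(ρ‖τ) ≤ S(ρ‖σ) + log c (`relEntropy_le_add_log`).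

To find τ, start from the Jordan decomposition σ^Γ = P - N and trade N away. Replacing N by N - vv†
and P by P + ww† adds (vv† + ww†)^Γ to (P - N)^Γ. With a qubit, w can be chosen no longer than v and
such that this term is positive (`exists_posSemidef_partialTranspose_add`), so (P - N)^Γ ≥ σ and Tr
P + Tr N ≤ c persist. An extremal pair has N = 0, and τ is P^Γ normalised.

A minimiser for E_P exists by compactness and `lowerSemicontinuousOn_relEntropy`; it also minimises
R. -/

namespace RainsPPT

/-! ### Operator logarithm and trace norm. -/

section CStar

open scoped Matrix.Norms.L2Operator MatrixOrder

theorem posSemidef_cfc_log_sub {n : Type*} [Fintype n] [DecidableEq n] {A B : Matrix n n ℂ}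
    (hA : A.PosDef) (hAB : (B - A).PosSemidef) :
    (cfc Real.log B - cfc Real.log A).PosSemidef := by
  have hA' : IsStrictlyPositive A := Matrix.isStrictlyPositive_iff_posDef.mpr hA
  exact Matrix.le_iff.mp (CFC.log_le_log (Matrix.le_iff.mpr hAB) hA')

theorem continuousOn_cfc_log (n : Type*) [Fintype n] [DecidableEq n] :
    ContinuousOn (fun A : Matrix n n ℂ => cfc Real.log A) {A | A.PosDef} := by
  refine (CFC.continuousOn_log (A := Matrix n n ℂ)).mono ?_
  intro A hA
  exact ⟨hA.1, hA.isUnit⟩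

theorem cfc_log_smul {n : Type*} [Fintype n] [DecidableEq n] {A : Matrix n n ℂ}
    (hA : A.PosDef) {c : ℝ} (hc : 0 < c) :
    cfc Real.log (c • A) = (Real.log c : ℂ) • 1 + cfc Real.log A := by
  have hA' : IsStrictlyPositive A := Matrix.isStrictlyPositive_iff_posDef.mpr hA
  have := CFC.log_smul' A hc hA'
  rw [CFC.log, CFC.log, Algebra.algebraMap_eq_smul_one] at this
  rw [this]
  congr 1

theorem traceNorm_of_posSemidef {n : Type*} [Fintype n] [DecidableEq n] {A : Matrix n n ℂ}
    (hA : A.PosSemidef) : traceNorm A = A.trace.re := by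
  have h := CFC.abs_of_nonneg A hA.nonneg
  rw [CFC.abs, CFC.sqrt_eq_real_sqrt _ (star_mul_self_nonneg A), cfcₙ_eq_cfc] at h
  rw [traceNorm, ← Matrix.star_eq_conjTranspose, h]

theorem exists_posSemidef_sub_eq {n : Type*} [Fintype n] [DecidableEq n] {A : Matrix n n ℂ}
    (hA : A.IsHermitian) : ∃ P N : Matrix n n ℂ, P.PosSemidef ∧ N.PosSemidef ∧ P - N = A ∧
      P.trace.re + N.trace.re = traceNorm A := by
  refine ⟨A⁺, A⁻, Matrix.nonneg_iff_posSemidef.mp (CFC.posPart_nonneg A),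
    Matrix.nonneg_iff_posSemidef.mp (CFC.negPart_nonneg A),
    CFC.posPart_sub_negPart A hA, ?_⟩
  have h := CFC.posPart_add_negPart A hA
  rw [CFC.abs, CFC.sqrt_eq_real_sqrt _ (star_mul_self_nonneg A), cfcₙ_eq_cfc] at h
  rw [traceNorm, ← Matrix.star_eq_conjTranspose, ← h, Matrix.trace_add, Complex.add_re]

end CStar

/-! ### Relative entropy: semicontinuity and monotonicity in the second argument. -/

section Entropy

open Filter Topology

variable {n : Type*} [Fintype n] [DecidableEq n]

/-- The weight `⟨uᵢ, A uᵢ⟩` of `A` on the `i`-th eigenvector of `B`. -/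
noncomputable def eigenWeight (A : Matrix n n ℂ) {B : Matrix n n ℂ} (hB : B.IsHermitian)
    (i : n) : ℝ :=
  (star ⇑(hB.eigenvectorBasis i) ⬝ᵥ (A *ᵥ ⇑(hB.eigenvectorBasis i))).re

theorem eigenWeight_nonneg {A B : Matrix n n ℂ} (hA : A.PosSemidef) (hB : B.IsHermitian) (i : n) :
    0 ≤ eigenWeight A hB i := hA.re_dotProduct_nonneg _

/-- The trace of `A * f(B)` in terms of an eigenbasis of `B`. -/
theorem re_trace_mul_cfc (A : Matrix n n ℂ) {B : Matrix n n ℂ} (hB : B.IsHermitian) (f : ℝ → ℝ) :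
    (A * cfc f B).trace.re = ∑ i, f (hB.eigenvalues i) * eigenWeight A hB i := by
  rw [hB.cfc_eq, Matrix.IsHermitian.cfc, Unitary.conjStarAlgAut_apply, ← mul_assoc,
    Matrix.trace_mul_comm, ← mul_assoc, ← mul_assoc, Matrix.trace_mul_comm, Matrix.trace, Complex.re_sum]
  refine Finset.sum_congr rfl fun i _ => ?_
  rw [Matrix.diag_apply, Matrix.diagonal_mul, eigenWeight, mul_assoc, Matrix.mul_apply']
  exact Complex.re_ofReal_mul _ _

theorem cfc_log_add_smul_one {B : Matrix n n ℂ} (hB : B.IsHermitian) (ε : ℝ) :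
    cfc Real.log (B + ε • 1) = cfc (fun x => Real.log (x + ε)) B := by
  -- On a finite spectrum every function is continuous, even `Real.log` at 0.
  have hfin : (spectrum ℝ B).Finite := by
    rw [hB.spectrum_real_eq_range_eigenvalues]
    exact Set.finite_range _
  have hB' : IsSelfAdjoint B := hB
  rw [cfc_comp' Real.log (fun x => x + ε) B ((hfin.image _).continuousOn _)
    (hfin.continuousOn _), cfc_add_const ε (fun x => x) B (hfin.continuousOn _), cfc_id' ℝ B,
    Algebra.algebraMap_eq_smul_one]

/-- The relative entropy with the second argument shifted by a multiple of the identity. -/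
noncomputable def shiftedRelEntropy (ρ σ : Matrix n n ℂ) (ε : ℝ) : ℝ :=
  (ρ * cfc Real.log ρ).trace.re - (ρ * cfc Real.log (σ + ε • 1)).trace.re

theorem shiftedRelEntropy_eq (ρ : Matrix n n ℂ) {σ : Matrix n n ℂ} (hσ : σ.IsHermitian) (ε : ℝ) :
    shiftedRelEntropy ρ σ ε = (ρ * cfc Real.log ρ).trace.re -
      ∑ i, Real.log (hσ.eigenvalues i + ε) * eigenWeight ρ hσ i := by
  rw [shiftedRelEntropy, cfc_log_add_smul_one hσ, re_trace_mul_cfc ρ hσ]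

theorem eigenWeight_eq_zero {ρ σ : Matrix n n ℂ} (hσ : σ.IsHermitian)
    (h : ∀ v : n → ℂ, σ *ᵥ v = 0 → ρ *ᵥ v = 0) {i : n} (hi : hσ.eigenvalues i = 0) :
    eigenWeight ρ hσ i = 0 := by
  have h1 : σ *ᵥ ⇑(hσ.eigenvectorBasis i) = 0 := by
    rw [hσ.mulVec_eigenvectorBasis, hi, zero_smul]
  rw [eigenWeight, h _ h1, dotProduct_zero, Complex.zero_re]

/-- Otherwise positivity of ρ would make it kill every null eigenvector of σ, and these span the
kernel of σ. -/
theorem exists_eigenWeight_pos {ρ σ : Matrix n n ℂ} (hρ : ρ.PosSemidef) (hσ : σ.IsHermitian)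
    (h : ¬ ∀ v : n → ℂ, σ *ᵥ v = 0 → ρ *ᵥ v = 0) :
    ∃ i, hσ.eigenvalues i = 0 ∧ 0 < eigenWeight ρ hσ i := by
  by_contra! hcon
  refine h fun v hv => ?_
  have hker : ∀ i, hσ.eigenvalues i = 0 → ρ *ᵥ ⇑(hσ.eigenvectorBasis i) = 0 := by
    intro i hi
    rw [← hρ.dotProduct_mulVec_zero_iff]
    have h0 := hρ.dotProduct_mulVec_nonneg ⇑(hσ.eigenvectorBasis i)
    have h1 := hcon i hi
    rw [Complex.nonneg_iff] at h0
    exact Complex.ext (le_antisymm h1 h0.1) h0.2.symm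
  have hexp := hσ.eigenvectorBasis.sum_repr' (WithLp.toLp 2 v)
  have hv' : v = ∑ i, inner ℂ (hσ.eigenvectorBasis i) (WithLp.toLp 2 v) •
      ⇑(hσ.eigenvectorBasis i) := by
    have := congrArg (WithLp.ofLp) hexp
    simpa using this.symm
  rw [hv', Matrix.mulVec_sum]
  refine Finset.sum_eq_zero fun i _ => ?_
  rw [Matrix.mulVec_smul]
  by_cases hi : hσ.eigenvalues i = 0
  · rw [hker i hi, smul_zero]
  · have h2 : (hσ.eigenvalues i : ℂ) * inner ℂ (hσ.eigenvectorBasis i) (WithLp.toLp 2 v) = 0 := by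
      have h3 : star (σ *ᵥ ⇑(hσ.eigenvectorBasis i)) ⬝ᵥ v = 0 := by
        rw [Matrix.star_mulVec, ← Matrix.dotProduct_mulVec, hσ.eq, hv, dotProduct_zero]
      rw [hσ.mulVec_eigenvectorBasis] at h3
      rw [EuclideanSpace.inner_eq_star_dotProduct]
      simpa [dotProduct_comm] using h3
    rw [(mul_eq_zero.mp h2).resolve_left (by exact_mod_cast hi), zero_smul]

theorem shiftedRelEntropy_le {ρ σ : Matrix n n ℂ} (hρ : ρ.PosSemidef) (hσ : σ.PosSemidef)
    {ε : ℝ} (hε : 0 < ε) : (shiftedRelEntropy ρ σ ε : EReal) ≤ relEntropy ρ σ := by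
  rw [relEntropy]
  split_ifs with h
  · rw [EReal.coe_le_coe_iff, shiftedRelEntropy_eq ρ hσ.1, re_trace_mul_cfc ρ hσ.1]
    refine sub_le_sub_left (Finset.sum_le_sum fun i _ => ?_) _
    rcases (hσ.eigenvalues_nonneg i).eq_or_lt with hi | hi
    · rw [eigenWeight_eq_zero hσ.1 h hi.symm, mul_zero, mul_zero]
    · exact mul_le_mul_of_nonneg_right (Real.log_le_log hi (by linarith))
        (eigenWeight_nonneg hρ hσ.1 i)
  · exact le_top

/-- The shifted entropies are continuous in σ, so this supremum, which covers the value `⊤` too,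
yields lower semicontinuity. -/
theorem relEntropy_eq_iSup {ρ σ : Matrix n n ℂ} (hρ : ρ.PosSemidef) (hσ : σ.PosSemidef) :
    relEntropy ρ σ = ⨆ ε : Set.Ioi (0 : ℝ), (shiftedRelEntropy ρ σ ε : EReal) := by
  refine le_antisymm ?_ (iSup_le fun ε => shiftedRelEntropy_le hρ hσ ε.2)
  have hle : ∀ ε : ℝ, 0 < ε → (shiftedRelEntropy ρ σ ε : EReal) ≤
      ⨆ ε : Set.Ioi (0 : ℝ), (shiftedRelEntropy ρ σ ε : EReal) := fun ε hε =>
    le_iSup (fun ε : Set.Ioi (0 : ℝ) => (shiftedRelEntropy ρ σ ε : EReal)) ⟨ε, hε⟩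
  rw [relEntropy]
  split_ifs with h
  · have ht : Tendsto (fun ε => shiftedRelEntropy ρ σ ε) (𝓝[>] 0)
        (𝓝 ((ρ * cfc Real.log ρ).trace.re - (ρ * cfc Real.log σ).trace.re)) := by
      simp_rw [shiftedRelEntropy_eq ρ hσ.1, re_trace_mul_cfc ρ hσ.1 Real.log]
      refine tendsto_const_nhds.sub (tendsto_finsetSum _ fun i _ => ?_)
      by_cases hi : hσ.1.eigenvalues i = 0
      · simp only [eigenWeight_eq_zero hσ.1 h hi, mul_zero]
        exact tendsto_const_nhds
      · refine Tendsto.mul_const _ (Tendsto.mono_left ?_ nhdsWithin_le_nhds)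
        have : ContinuousAt (fun ε => Real.log (hσ.1.eigenvalues i + ε)) 0 :=
          ContinuousAt.log (by fun_prop) (by simpa using hi)
        simpa [ContinuousAt] using this
    refine le_of_tendsto ((continuous_coe_real_ereal.tendsto _).comp ht) ?_
    filter_upwards [self_mem_nhdsWithin] with ε hε using hle ε hε
  · obtain ⟨i, hi, hw⟩ := exists_eigenWeight_pos hρ hσ.1 h
    refine le_of_tendsto (f := fun ε => (shiftedRelEntropy ρ σ ε : EReal)) (x := 𝓝[>] 0) ?_
      (by filter_upwards [self_mem_nhdsWithin] with ε hε using hle ε hε)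
    refine EReal.tendsto_coe_nhds_top_iff.mpr ?_
    -- For ε ≤ 1 each log(λⱼ + ε) with j ≠ i is at most log(λⱼ + 1). The extra j = i term is log 1 =
    -- 0, so the full sum can be kept.
    have hlog : Tendsto (fun ε => ((ρ * cfc Real.log ρ).trace.re -
        ∑ j, Real.log (hσ.1.eigenvalues j + 1) * eigenWeight ρ hσ.1 j) +
        -(Real.log ε * eigenWeight ρ hσ.1 i)) (𝓝[>] 0) atTop :=
      tendsto_atTop_add_const_left _ _ (tendsto_neg_atBot_atTop.comp
        (Real.tendsto_log_nhdsGT_zero.atBot_mul_const hw))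
    refine tendsto_atTop_mono' _ ?_ hlog
    filter_upwards [Ioc_mem_nhdsGT (zero_lt_one' ℝ)] with ε hε
    rw [shiftedRelEntropy_eq ρ hσ.1, sub_add, sub_neg_eq_add]
    refine sub_le_sub_left ?_ _
    rw [← Finset.sum_erase_add _ _ (Finset.mem_univ i),
      ← Finset.sum_erase_add (a := i) Finset.univ _ (Finset.mem_univ i), hi, zero_add, zero_add,
      Real.log_one, zero_mul, add_zero]
    refine add_le_add_left (Finset.sum_le_sum fun j _ => ?_) _
    have := hσ.eigenvalues_nonneg j
    exact mul_le_mul_of_nonneg_right (Real.log_le_log (by linarith [hε.1]) (by linarith [hε.2]))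
        (eigenWeight_nonneg hρ hσ.1 j)

omit [Fintype n] in
theorem posDef_add_smul_one {σ : Matrix n n ℂ} (hσ : σ.PosSemidef) {ε : ℝ} (hε : 0 < ε) :
    (σ + ε • 1).PosDef :=
  Matrix.PosDef.posSemidef_add hσ (Matrix.PosDef.one.smul hε)

theorem lowerSemicontinuousOn_relEntropy {ρ : Matrix n n ℂ} (hρ : ρ.PosSemidef) :
    LowerSemicontinuousOn (relEntropy ρ) {σ | σ.PosSemidef} := by
  have h : LowerSemicontinuousOn
      (fun σ => ⨆ ε : Set.Ioi (0 : ℝ), (shiftedRelEntropy ρ σ ε : EReal)) {σ | σ.PosSemidef} := by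
    refine lowerSemicontinuousOn_iSup fun ε => ContinuousOn.lowerSemicontinuousOn ?_
    refine continuous_coe_real_ereal.comp_continuousOn ?_
    have h1 : ContinuousOn (fun σ : Matrix n n ℂ => cfc Real.log (σ + (ε : ℝ) • 1))
        {σ | σ.PosSemidef} :=
      (continuousOn_cfc_log n).comp (by fun_prop) fun σ hσ => posDef_add_smul_one hσ ε.2
    have h2 : Continuous fun A : Matrix n n ℂ => (ρ * A).trace.re :=
      Complex.continuous_re.comp (Continuous.matrix_trace (by fun_prop))
    exact continuousOn_const.sub (h2.comp_continuousOn h1)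
  intro σ hσ c hc
  rw [relEntropy_eq_iSup hρ hσ] at hc
  filter_upwards [h σ hσ c hc, self_mem_nhdsWithin] with τ hτ hτ'
  rwa [relEntropy_eq_iSup hρ hτ']

theorem re_trace_mul_nonneg {A B : Matrix n n ℂ} (hA : A.PosSemidef) (hB : B.PosSemidef) :
    0 ≤ (A * B).trace.re := by
  have hid : cfc (fun x : ℝ => x) B = B := cfc_id' ℝ B hB.1
  rw [← hid, re_trace_mul_cfc A hB.1]
  exact Finset.sum_nonneg fun i _ => mul_nonneg (hB.eigenvalues_nonneg i)
    (eigenWeight_nonneg hA hB.1 i)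

/-- If `σ ≤ c τ`, then `S(ρ‖τ) ≤ S(ρ‖σ) + log c`. -/
theorem relEntropy_le_add_log {ρ σ τ : Matrix n n ℂ} (hρ : ρ ∈ states n) (hσ : σ.PosSemidef)
    (hτ : τ.PosSemidef) {c : ℝ} (hc : 0 < c) (h : (c • τ - σ).PosSemidef) :
    relEntropy ρ τ ≤ relEntropy ρ σ + (Real.log c : EReal) := by
  rw [relEntropy_eq_iSup hρ.1 hτ]
  refine iSup_le fun ε => ?_
  have hε : (0 : ℝ) < ε := ε.2
  -- Shifting σ by cε matches the shift of τ by ε: c(τ + ε) - (σ + cε) = cτ - σ.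
  refine le_trans ?_ (add_le_add_left (shiftedRelEntropy_le hρ.1 hσ (mul_pos hc hε)) _)
  rw [← EReal.coe_add, EReal.coe_le_coe_iff, shiftedRelEntropy, shiftedRelEntropy]
  have h1 := cfc_log_smul (posDef_add_smul_one hτ hε) hc
  have h2 := posSemidef_cfc_log_sub (posDef_add_smul_one hσ (mul_pos hc hε))
    (B := c • (τ + (ε : ℝ) • 1)) (by
      convert h using 1
      rw [smul_add, smul_smul]
      abel)
  have h3 := re_trace_mul_nonneg hρ.1 h2
  rw [h1, mul_sub, mul_add, Matrix.trace_sub, Matrix.trace_add, Matrix.mul_smul, mul_one,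
    Matrix.trace_smul, hρ.2, smul_eq_mul, mul_one, Complex.sub_re, Complex.add_re,
    Complex.ofReal_re] at h3
  linarith

end Entropy

/-- The pᵢ will be the squared lengths of the two blocks of v. Scaling the blocks by c with c₀c₁ =
-1 cancels the cross terms of vv†; the choice below swaps the two lengths. -/
theorem exists_swap_coefficients {ι : Type*} [Fintype ι] (hι : Fintype.card ι = 2) (p : ι → ℝ)
    (hp : ∀ i, 0 ≤ p i) : ∃ c : ι → ℝ, (∀ i j, i ≠ j → p i = 0 ∨ p j = 0 ∨ 1 + c i * c j = 0) ∧
      ∑ i, c i ^ 2 * p i ≤ ∑ i, p i := by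
  classical
  by_cases h0 : ∃ i, p i = 0
  · obtain ⟨i₀, hi₀⟩ := h0
    refine ⟨0, fun i j hij => ?_, Finset.sum_le_sum fun i _ => by simpa using hp i⟩
    have : i = i₀ ∨ j = i₀ := by
      by_contra! h
      have h3 : ({i, j, i₀} : Finset ι).card = 3 := Finset.card_eq_three.mpr
        ⟨i, j, i₀, hij, h.1, h.2, rfl⟩
      have := Finset.card_le_univ ({i, j, i₀} : Finset ι)
      omega
    rcases this with rfl | rfl
    · exact Or.inl hi₀
    · exact Or.inr (Or.inl hi₀)
  · push Not at h0
    obtain ⟨a, b, hab, hu⟩ := Finset.card_eq_two.mp ((Finset.card_univ (α := ι)).trans hι)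
    have hmem : ∀ i, i = a ∨ i = b := fun i => by
      have := Finset.mem_univ i
      rw [hu] at this
      simpa using this
    have hprod : √(p b / p a) * √(p a / p b) = 1 := by
      rw [← Real.sqrt_mul (div_nonneg (hp b) (hp a)), div_mul_div_cancel₀ (h0 a),
        div_self (h0 b), Real.sqrt_one]
    refine ⟨fun i => if i = a then √(p b / p a) else -√(p a / p b), fun i j hij => ?_, ?_⟩
    · refine Or.inr (Or.inr ?_)
      rcases hmem i with rfl | rfl <;> rcases hmem j with rfl | rfl
      · exact absurd rfl hij
      · simp only [if_true, if_neg hab.symm]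
        linarith
      · simp only [if_true, if_neg hab.symm]
        linarith
      · exact absurd rfl hij
    · simp only [hu, Finset.sum_pair hab]
      rw [if_pos trivial, if_neg hab.symm, neg_sq,
        Real.sq_sqrt (div_nonneg (hp b) (hp a)), Real.sq_sqrt (div_nonneg (hp a) (hp b)),
        div_mul_cancel₀ _ (h0 a), div_mul_cancel₀ _ (h0 b), add_comm]

/-! ### Compactness and rank-one pieces of positive semidefinite matrices. -/

section Bounded

variable {n : Type*}

open scoped MatrixOrder Matrix.Norms.L2Operator in
theorem exists_conjTranspose_mul_self_eq [Fintype n] {A : Matrix n n ℂ} (hA : A.PosSemidef) :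
    ∃ B : Matrix n n ℂ, A = Bᴴ * B := by
  classical
  exact CStarAlgebra.nonneg_iff_eq_star_mul_self.mp hA.nonneg

/-- The entries of a positive semidefinite matrix are bounded by its trace. -/
theorem norm_apply_le_re_trace [Fintype n] {A : Matrix n n ℂ} (hA : A.PosSemidef) (i j : n) :
    ‖A i j‖ ≤ A.trace.re := by
  classical
  obtain ⟨B, rfl⟩ := exists_conjTranspose_mul_self_eq hA
  have hd : ∀ i, ((Bᴴ * B) i i).re = ∑ l, ‖B l i‖ ^ 2 := fun i => by
    rw [Matrix.mul_apply, Complex.re_sum]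
    refine Finset.sum_congr rfl fun l _ => ?_
    rw [Matrix.conjTranspose_apply, Complex.star_def, mul_comm, Complex.mul_conj,
      Complex.ofReal_re, Complex.normSq_eq_norm_sq]
  have htr : ∀ i, ∑ l, ‖B l i‖ ^ 2 ≤ (Bᴴ * B).trace.re := fun i => by
    rw [Matrix.trace, Complex.re_sum]
    simp only [Matrix.diag_apply, hd]
    exact Finset.single_le_sum (f := fun i => ∑ l, ‖B l i‖ ^ 2)
      (fun _ _ => Finset.sum_nonneg fun _ _ => sq_nonneg _) (Finset.mem_univ i)
  calc ‖(Bᴴ * B) i j‖ ≤ ∑ l, ‖B l i‖ * ‖B l j‖ := by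
        rw [Matrix.mul_apply]
        refine (norm_sum_le _ _).trans (le_of_eq (Finset.sum_congr rfl fun l _ => ?_))
        rw [norm_mul, Matrix.conjTranspose_apply, norm_star]
    _ ≤ ∑ l, (‖B l i‖ ^ 2 + ‖B l j‖ ^ 2) / 2 := Finset.sum_le_sum fun l _ => by
        nlinarith [sq_nonneg (‖B l i‖ - ‖B l j‖)]
    _ = (∑ l, ‖B l i‖ ^ 2 + ∑ l, ‖B l j‖ ^ 2) / 2 := by
        rw [← Finset.sum_div, Finset.sum_add_distrib]
    _ ≤ _ := by linarith [htr i, htr j]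

theorem isClosed_posSemidef [Fintype n] : IsClosed {A : Matrix n n ℂ | A.PosSemidef} := by
  have : {A : Matrix n n ℂ | A.PosSemidef} =
      {A | Aᴴ = A} ∩ ⋂ x : n → ℂ, {A | 0 ≤ star x ⬝ᵥ (A *ᵥ x)} := by
    ext A
    simp only [Matrix.posSemidef_iff_dotProduct_mulVec, Set.mem_ofPred_eq, Set.mem_inter_iff,
      Set.mem_iInter]
    rfl
  rw [this]
  refine (isClosed_eq (by fun_prop) continuous_id).inter (isClosed_iInter fun x => ?_)
  refine isClosed_le continuous_const ?_
  fun_prop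

theorem isCompact_posSemidef_trace_le (n : Type*) [Fintype n] (c : ℝ) :
    IsCompact {A : Matrix n n ℂ | A.PosSemidef ∧ A.trace.re ≤ c} := by
  have hc : IsCompact (Set.pi Set.univ fun _ : n => Set.pi Set.univ fun _ : n =>
      Metric.closedBall (0 : ℂ) c) :=
    isCompact_univ_pi fun _ => isCompact_univ_pi fun _ => isCompact_closedBall _ _
  refine IsCompact.of_isClosed_subset (s := (Set.pi Set.univ fun _ : n =>
      Set.pi Set.univ fun _ : n => Metric.closedBall (0 : ℂ) c : Set (Matrix n n ℂ))) hc ?_ ?_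
  · exact isClosed_posSemidef.inter (isClosed_le
      (Complex.continuous_re.comp (Continuous.matrix_trace continuous_id)) continuous_const)
  · intro A hA i _ j _
    rw [mem_closedBall_zero_iff]
    exact (norm_apply_le_re_trace hA.1 i j).trans hA.2

/-- B†B is a sum of rank-one terms, one per row of B; v comes from a nonzero row. -/
theorem exists_sub_vecMulVec_posSemidef [Fintype n] {N : Matrix n n ℂ} (hN : N.PosSemidef)
    (h0 : N ≠ 0) : ∃ v : n → ℂ, v ≠ 0 ∧ (N - Matrix.vecMulVec v (star v)).PosSemidef := by
  classical
  obtain ⟨B, rfl⟩ := exists_conjTranspose_mul_self_eq hN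
  have hrow : ∃ l, B l ≠ 0 := by
    by_contra! h
    exact h0 (by rw [show B = 0 from funext h, mul_zero])
  obtain ⟨l, hl⟩ := hrow
  refine ⟨star (B l), star_ne_zero.mpr hl, ?_⟩
  have : Bᴴ * B - Matrix.vecMulVec (star (B l)) (star (star (B l))) =
      ∑ i ∈ Finset.univ.erase l, Matrix.vecMulVec (star (B i)) (B i) := by
    rw [sub_eq_iff_eq_add, star_star, Finset.sum_erase_add _ _ (Finset.mem_univ l)]
    ext i j
    simp [Matrix.mul_apply, Matrix.sum_apply, Matrix.vecMulVec_apply]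
  rw [this]
  exact Matrix.posSemidef_sum _ fun i _ => Matrix.posSemidef_vecMulVec_star_self (B i)

end Bounded

/-! ### Completing a rank-one operator in a qubit system. -/

theorem re_trace_vecMulVec_self_star {n : Type*} [Fintype n] (v : n → ℂ) :
    (Matrix.vecMulVec v (star v)).trace.re = ∑ x, ‖v x‖ ^ 2 := by
  rw [Matrix.trace, Complex.re_sum]
  refine Finset.sum_congr rfl fun x _ => ?_
  rw [Matrix.diag_apply, Matrix.vecMulVec_apply, Pi.star_apply, Complex.star_def,
    Complex.mul_conj, Complex.ofReal_re, Complex.normSq_eq_norm_sq]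

/-- If `f` takes two values, then `v v† + w w†` is block diagonal with respect to the fibres of `f`
for some `w` which is not longer than `v`. -/
theorem exists_blockDiagonal_add {n ι : Type*} [Fintype n] [Fintype ι] [DecidableEq ι]
    (hι : Fintype.card ι = 2) (f : n → ι) (v : n → ℂ) :
    ∃ (w : n → ℂ) (d : ι → ℝ), (∀ i, 0 ≤ d i) ∧ ∑ x, ‖w x‖ ^ 2 ≤ ∑ x, ‖v x‖ ^ 2 ∧
      ∀ x y, (Matrix.vecMulVec v (star v) + Matrix.vecMulVec w (star w)) x y =
        if f x = f y then d (f x) * (v x * star (v y)) else 0 := by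
  obtain ⟨c, hc, hsum⟩ := exists_swap_coefficients hι
    (fun i => ∑ x with f x = i, ‖v x‖ ^ 2) fun i => Finset.sum_nonneg fun _ _ => sq_nonneg _
  refine ⟨fun x => c (f x) * v x, fun i => 1 + c i ^ 2, fun i => by positivity, ?_, fun x y => ?_⟩
  · rw [Finset.sum_fiberwise] at hsum
    refine le_trans (le_of_eq ?_) hsum
    rw [← Finset.sum_fiberwise Finset.univ f]
    refine Finset.sum_congr rfl fun i _ => ?_
    rw [Finset.mul_sum]
    refine Finset.sum_congr rfl fun x hx => ?_
    rw [Finset.mem_filter] at hx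
    rw [norm_mul, mul_pow, hx.2, Complex.norm_real, Real.norm_eq_abs, sq_abs]
  · have hxy : (Matrix.vecMulVec v (star v) + Matrix.vecMulVec (fun x => c (f x) * v x)
        (star fun x => c (f x) * v x)) x y =
        (1 + c (f x) * c (f y) : ℝ) * (v x * star (v y)) := by
      simp only [Matrix.add_apply, Matrix.vecMulVec_apply, Pi.star_apply, star_mul',
        Complex.star_def, Complex.conj_ofReal]
      push_cast
      ring
    have hz : ∀ z, ∑ x with f x = f z, ‖v x‖ ^ 2 = 0 → v z = 0 := fun z hz => by
      rw [Finset.sum_eq_zero_iff_of_nonneg fun _ _ => sq_nonneg _] at hz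
      simpa using hz z (by simp)
    rw [hxy]
    split_ifs with h
    · simp only [h, sq]
    · rcases hc _ _ h with h1 | h1 | h1
      · rw [hz x h1, zero_mul, mul_zero]
      · rw [hz y h1, star_zero, mul_zero, mul_zero]
      · rw [h1, Complex.ofReal_zero, zero_mul]

/-- A is a nonnegative combination of rank-one projectors (unnormalised) onto the restrictions of u
to the fibres of `f`. -/
theorem posSemidef_of_blockDiagonal {n ι : Type*} [Fintype n] [Fintype ι] [DecidableEq ι]
    (f : n → ι) (u : n → ℂ) {d : ι → ℝ} (hd : ∀ i, 0 ≤ d i) {A : Matrix n n ℂ}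
    (hA : ∀ x y, A x y = if f x = f y then d (f x) * (u x * star (u y)) else 0) :
    A.PosSemidef := by
  have : A = ∑ i, d i • Matrix.vecMulVec (fun x => if f x = i then u x else 0)
      (star fun x => if f x = i then u x else 0) := by
    ext x y
    rw [hA, Matrix.sum_apply, Finset.sum_eq_single (f x)]
    · by_cases h : f x = f y
      · simp [Matrix.vecMulVec_apply, h]
      · simp [Matrix.vecMulVec_apply, h, Ne.symm h]
    · intro i _ hi
      simp [Matrix.vecMulVec_apply, hi.symm]
    · simp
  rw [this]
  exact Matrix.posSemidef_sum _ fun i _ =>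
    (Matrix.posSemidef_vecMulVec_self_star _).smul (hd i)

variable {m k : Type*} [Fintype m] [DecidableEq m] [Fintype k] [DecidableEq k]

/-- With a qubit subsystem, every rank one operator `v v†` can be completed to an operator with
positive partial transpose by adding some `w w†` of no larger trace. -/
theorem exists_posSemidef_partialTranspose_add (hqubit : Fintype.card m = 2 ∨ Fintype.card k = 2)
    (v : m × k → ℂ) : ∃ w : m × k → ℂ, ∑ x, ‖w x‖ ^ 2 ≤ ∑ x, ‖v x‖ ^ 2 ∧
      (partialTranspose (Matrix.vecMulVec v (star v) +
        Matrix.vecMulVec w (star w))).PosSemidef := by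
  rcases hqubit with h | h
  · obtain ⟨w, d, hd, hw, hD⟩ := exists_blockDiagonal_add h Prod.fst v
    -- Blocks are indexed by the first factor, so Γ transposes each block, which conjugates v.
    refine ⟨w, hw, posSemidef_of_blockDiagonal Prod.fst (star v) hd fun x y => ?_⟩
    rw [partialTranspose, Matrix.of_apply, hD]
    by_cases hxy : x.1 = y.1
    · rw [if_pos hxy, if_pos hxy, Pi.star_apply, Pi.star_apply, star_star, mul_comm (v _),
        ← hxy, Prod.mk.eta]
      conv_rhs => rw [← Prod.mk.eta (p := y), ← hxy]
    · rw [if_neg hxy, if_neg hxy]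
  · obtain ⟨w, d, hd, hw, hD⟩ := exists_blockDiagonal_add h Prod.snd v
    -- Blocks are indexed by the transposed factor, so Γ fixes the matrix.
    refine ⟨w, hw, posSemidef_of_blockDiagonal Prod.snd v hd fun x y => ?_⟩
    rw [partialTranspose, Matrix.of_apply, hD]
    by_cases hxy : x.2 = y.2
    · rw [if_pos hxy.symm, if_pos hxy, ← hxy, Prod.mk.eta]
      conv_rhs => rw [← Prod.mk.eta (p := y), ← hxy]
    · rw [if_neg (Ne.symm hxy), if_neg hxy]

/-! ### Partial transposition and domination by PPT states. -/

section PartialTranspose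

omit [Fintype m] [DecidableEq m] [Fintype k] [DecidableEq k]

theorem partialTranspose_add (A B : Matrix (m × k) (m × k) ℂ) :
    partialTranspose (A + B) = partialTranspose A + partialTranspose B := rfl

theorem partialTranspose_sub (A B : Matrix (m × k) (m × k) ℂ) :
    partialTranspose (A - B) = partialTranspose A - partialTranspose B := rfl

theorem partialTranspose_partialTranspose (A : Matrix (m × k) (m × k) ℂ) :
    partialTranspose (partialTranspose A) = A := rfl

theorem trace_partialTranspose [Fintype m] [Fintype k] (A : Matrix (m × k) (m × k) ℂ) :
    (partialTranspose A).trace = A.trace := rfl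

theorem isHermitian_partialTranspose {A : Matrix (m × k) (m × k) ℂ} (hA : A.IsHermitian) :
    (partialTranspose A).IsHermitian :=
  Matrix.IsHermitian.ext fun x y => hA.apply (x.1, y.2) (y.1, x.2)

theorem continuous_partialTranspose :
    Continuous (partialTranspose : Matrix (m × k) (m × k) ℂ → Matrix (m × k) (m × k) ℂ) :=
  continuous_matrix fun _ _ => continuous_id.matrix_elem _ _

end PartialTranspose

theorem isCompact_pptStates (m k : Type*) [Fintype m] [Fintype k] :
    IsCompact (pptStates m k) := by
  have : pptStates m k = {A : Matrix (m × k) (m × k) ℂ | A.PosSemidef ∧ A.trace.re ≤ 1} ∩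
      ({A | A.trace = 1} ∩ {A | (partialTranspose A).PosSemidef}) := by
    ext A
    simp only [pptStates, states, Set.mem_ofPred_eq, Set.mem_inter_iff]
    constructor
    · rintro ⟨⟨h1, h2⟩, h3⟩
      exact ⟨⟨h1, by simp [h2]⟩, h2, h3⟩
    · rintro ⟨⟨h1, -⟩, h2, h3⟩
      exact ⟨⟨h1, h2⟩, h3⟩
  rw [this]
  exact (isCompact_posSemidef_trace_le _ 1).inter_right
    ((isClosed_eq (Continuous.matrix_trace continuous_id) continuous_const).inter
      (isClosed_posSemidef.preimage continuous_partialTranspose))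

/-- With a qubit subsystem, any positive semidefinite operator is dominated by one with positive
partial transpose whose trace is the trace norm of the partial transpose of the given one. -/
theorem exists_ppt_dominating (hqubit : Fintype.card m = 2 ∨ Fintype.card k = 2)
    {σ : Matrix (m × k) (m × k) ℂ} (hσ : σ.PosSemidef) :
    ∃ P : Matrix (m × k) (m × k) ℂ, P.PosSemidef ∧
      P.trace.re ≤ traceNorm (partialTranspose σ) ∧ (partialTranspose P - σ).PosSemidef := by
  set c := traceNorm (partialTranspose σ)
  let T : Set (Matrix (m × k) (m × k) ℂ × Matrix (m × k) (m × k) ℂ) :=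
    ({A | A.PosSemidef ∧ A.trace.re ≤ c} ×ˢ {A | A.PosSemidef ∧ A.trace.re ≤ c}) ∩
      ({X | X.1.trace.re + X.2.trace.re ≤ c} ∩
        {X | (partialTranspose (X.1 - X.2) - σ).PosSemidef})
  have htr : Continuous fun A : Matrix (m × k) (m × k) ℂ => A.trace.re :=
    Complex.continuous_re.comp (Continuous.matrix_trace continuous_id)
  have hT : IsCompact T := by
    refine ((isCompact_posSemidef_trace_le _ c).prod
      (isCompact_posSemidef_trace_le _ c)).inter_right (IsClosed.inter ?_ ?_)
    · exact isClosed_le ((htr.comp continuous_fst).add (htr.comp continuous_snd)) continuous_const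
    · exact isClosed_posSemidef.preimage ((continuous_partialTranspose.comp
        (continuous_fst.sub continuous_snd)).sub continuous_const)
  have hre : ∀ {A : Matrix (m × k) (m × k) ℂ}, A.PosSemidef → 0 ≤ A.trace.re := fun hA =>
    (Complex.nonneg_iff.mp hA.trace_nonneg).1
  have hmem : ∀ {P N : Matrix (m × k) (m × k) ℂ}, P.PosSemidef → N.PosSemidef →
      P.trace.re + N.trace.re ≤ c → (partialTranspose (P - N) - σ).PosSemidef → (P, N) ∈ T :=
    fun hP hN h1 h2 => ⟨⟨⟨hP, by linarith [hre hN]⟩, hN, by linarith [hre hP]⟩, h1, h2⟩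
  have hne : T.Nonempty := by
    obtain ⟨P, N, hP, hN, hPN, hsum⟩ :=
      exists_posSemidef_sub_eq (isHermitian_partialTranspose hσ.1)
    refine ⟨(P, N), hmem hP hN hsum.le ?_⟩
    rw [hPN, partialTranspose_partialTranspose, sub_self]
    exact .zero
  -- Maximise Tr(P - N): an exchange would raise it by |v|² + |w|² > 0.
  obtain ⟨⟨P, N⟩, ⟨⟨⟨hP, hPc⟩, hN, -⟩, hsum, hdom⟩, hmax⟩ := hT.exists_isMaxOn hne
    ((htr.comp (continuous_fst.sub continuous_snd)).continuousOn)
  have hN0 : N = 0 := by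
    by_contra h0
    obtain ⟨v, hv, hNv⟩ := exists_sub_vecMulVec_posSemidef hN h0
    obtain ⟨w, hw, hD⟩ := exists_posSemidef_partialTranspose_add hqubit v
    have hv' : 0 < ∑ x, ‖v x‖ ^ 2 := by
      obtain ⟨x, hx⟩ := Function.ne_iff.mp hv
      exact Finset.sum_pos' (fun _ _ => sq_nonneg _)
        ⟨x, Finset.mem_univ x, pow_pos (norm_pos_iff.mpr hx) 2⟩
    have hw' : 0 ≤ ∑ x, ‖w x‖ ^ 2 := Finset.sum_nonneg fun _ _ => sq_nonneg _
    have hmem' := hmem (P := P + Matrix.vecMulVec w (star w))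
      (N := N - Matrix.vecMulVec v (star v))
      (hP.add (Matrix.posSemidef_vecMulVec_self_star w)) hNv (by
        rw [Matrix.trace_add, Matrix.trace_sub, Complex.add_re, Complex.sub_re,
          re_trace_vecMulVec_self_star, re_trace_vecMulVec_self_star]
        simp only [Set.mem_ofPred_eq] at hsum
        linarith) (by
        convert Matrix.PosSemidef.add hdom hD using 1
        simp only [partialTranspose_add, partialTranspose_sub]
        abel)
    have h := hmax hmem'
    simp only [Set.mem_ofPred_eq, Function.comp_apply, Pi.sub_apply, Matrix.trace_add, Matrix.trace_sub,
      Complex.add_re, Complex.sub_re, re_trace_vecMulVec_self_star] at h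
    linarith
  refine ⟨P, hP, hPc, ?_⟩
  simpa only [hN0, sub_zero, Set.mem_ofPred_eq] using hdom

theorem exists_pptState_dominating (hqubit : Fintype.card m = 2 ∨ Fintype.card k = 2)
    {σ : Matrix (m × k) (m × k) ℂ} (hσ : σ ∈ states (m × k)) :
    0 < traceNorm (partialTranspose σ) ∧
      ∃ τ ∈ pptStates m k, (traceNorm (partialTranspose σ) • τ - σ).PosSemidef := by
  obtain ⟨P, hP, hPc, hdom⟩ := exists_ppt_dominating hqubit hσ.1
  set c := traceNorm (partialTranspose σ)
  have hge : 1 ≤ P.trace.re := by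
    have := (Complex.nonneg_iff.mp hdom.trace_nonneg).1
    rw [Matrix.trace_sub, trace_partialTranspose, hσ.2, Complex.sub_re, Complex.one_re] at this
    linarith
  have hpos : 0 < P.trace.re := by linarith
  have htrace : P.trace = (P.trace.re : ℂ) :=
    Complex.ext rfl (Complex.nonneg_iff.mp hP.trace_nonneg).2.symm
  have hPT : (partialTranspose P).PosSemidef := by
    simpa only [sub_add_cancel] using hdom.add hσ.1
  refine ⟨by linarith, P.trace.re⁻¹ • partialTranspose P,
    ⟨⟨hPT.smul (inv_nonneg.mpr hpos.le), ?_⟩, hP.smul (inv_nonneg.mpr hpos.le)⟩, ?_⟩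
  · rw [Matrix.trace_smul, trace_partialTranspose, htrace, Complex.ofReal_re, Complex.real_smul,
      ← Complex.ofReal_mul, inv_mul_cancel₀ hpos.ne', Complex.ofReal_one]
  -- cτ - σ = (P^Γ - σ) + (c / Tr P - 1) P^Γ.
  · have h1 : 0 ≤ c * P.trace.re⁻¹ - 1 := by
      rw [sub_nonneg, ← div_eq_mul_inv, one_le_div hpos]
      exact hPc
    convert hdom.add (hPT.smul h1) using 1
    rw [sub_smul, smul_smul, one_smul]
    abel

theorem logNegativity_eq_zero {σ : Matrix (m × k) (m × k) ℂ} (hσ : σ ∈ pptStates m k) :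
    logNegativity σ = 0 := by
  rw [logNegativity, traceNorm_of_posSemidef hσ.2, trace_partialTranspose, hσ.1.2,
    Complex.one_re, Real.log_one]

end RainsPPT

theorem mainTheorem1 {m k : Type*} [Fintype m] [DecidableEq m] [Fintype k] [DecidableEq k]
    (hqubit : Fintype.card m = 2 ∨ Fintype.card k = 2)
    (ρ : Matrix (m × k) (m × k) ℂ) (hρ : ρ ∈ RainsPPT.states (m × k)) :
    (∃ σ ∈ RainsPPT.states (m × k),
        RainsPPT.relEntropy ρ σ + (RainsPPT.logNegativity σ : EReal) = RainsPPT.rainsBound ρ) ∧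
      (∃ σ ∈ RainsPPT.pptStates m k,
        RainsPPT.relEntropy ρ σ = RainsPPT.pptRelEntropyEntanglement ρ) ∧
      RainsPPT.rainsBound ρ = RainsPPT.pptRelEntropyEntanglement ρ := by
  open RainsPPT in
  -- Only provides a PPT state, so that the minimum is over a nonempty set.
  obtain ⟨-, τ₀, hτ₀, -⟩ := exists_pptState_dominating hqubit hρ
  obtain ⟨τ, hτ, hmin⟩ := LowerSemicontinuousOn.exists_isMinOn ⟨τ₀, hτ₀⟩ (isCompact_pptStates m k)
    ((lowerSemicontinuousOn_relEntropy hρ.1).mono fun σ hσ => hσ.1.1)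
  have hE : relEntropy ρ τ = pptRelEntropyEntanglement ρ :=
    le_antisymm (le_iInf₂ fun σ hσ => hmin hσ) (iInf₂_le τ hτ)
  have hτ' : relEntropy ρ τ + (logNegativity τ : EReal) = relEntropy ρ τ := by
    rw [logNegativity_eq_zero hτ, EReal.coe_zero, add_zero]
  have hR : rainsBound ρ = pptRelEntropyEntanglement ρ := by
    refine le_antisymm ?_ (le_iInf₂ fun σ hσ => ?_)
    · rw [← hE, ← hτ']
      exact iInf₂_le τ hτ.1
    · obtain ⟨hc, ω, hω, hdom⟩ := exists_pptState_dominating hqubit hσ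
      exact (iInf₂_le ω hω).trans (relEntropy_le_add_log hρ hσ.1 hω.1.1 hc hdom)
  exact ⟨⟨τ, hτ.1, hτ'.trans (hE.trans hR.symm)⟩, ⟨τ, hτ, hE⟩, hR⟩
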